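/- Let $\mathbb{F}$ be an arbitrary field, let $V_1,V_2,V_3$ be finite-dimensional vector spaces over $\mathbb{F}$, and let $t\in V_1\otimes V_2\otimes V_3$ be a tight tensor: there are bases $(v_{i,a})_{a\in[n_i]}$ of $V_i$ ($n_i=\dim V_i$, $i=1,2,3$) and injective maps $u_i:[n_i]\to\mathbb{Z}$ such that $u_1(a_1)+u_2(a_2)+u_3(a_3)=0$ whenever the coefficient of $v_{1,a_1}\otimes v_{2,a_2}\otimes v_{3,a_3}$ in $t$ is nonzero. View $t^{\otimes n}$ as a 3-tensor in $V_1^{\otimes n}\otimes V_2^{\otimes n}\otimes V_3^{\otimes n}$. For a 3-tensor $s \in W_1\otimes W_2\otimes W_3$, with $W_1,W_2,W_3$ finite-dimensional vector spaces over $\mathbb{F}$, the slice rank $\mathrm{SR}(s)$ is the smallest $r$ such that $s$ is a sum of $r$ slices, a slice being a tensor of the form $v\otimes w$ with $v\in W_j$ and $w\in\bigotimes_{i\ne j}W_i$ for some $j\in\{1,2,3\}$; the subrank $\mathrm{Q}(s)$ is the largest $r$ for which there are linear maps $A_i:W_i\to\mathbb{F}^r$ with $(A_1\otimes A_2\otimes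 A_3)s=\sum_{j=1}^r e_j\otimes e_j\otimes e_j$. Then the limit $\lim_{n\to\infty}\mathrm{SR}(t^{\otimes n})^{1/n}$ (the asymptotic slice rank of $t$) exists, and it equals the asymptotic subrank of $t$: the limit $\lim_{n\to\infty}\mathrm{Q}(t^{\otimes n})^{1/n}$ also exists and $$\lim_{n\to\infty}\mathrm{SR}(t^{\otimes n})^{1/n}=\lim_{n\to\infty}\mathrm{Q}(t^{\otimes n})^{1/n}.$$ -/

import Mathlib

open scoped TensorProduct

noncomputable section

namespace TensorRanks

open Module PiTensorProduct

/-- Juxtaposition `V^{⊗n} × V → V^{⊗(n+1)}`, `(x₁ ⊗ ⋯ ⊗ xₙ, v) ↦ x₁ ⊗ ⋯ ⊗ xₙ ⊗ v`, as a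
bilinear map (see `snocMap_tprod`). -/
def snocMap (F : Type*) [Field F] (V : Type*) [AddCommGroup V] [Module F V] (n : ℕ) :
    (⨂[F]^n V) →ₗ[F] V →ₗ[F] (⨂[F]^(n + 1) V) :=
  ((TensorProduct.mk F (⨂[F]^n V) (⨂[F]^1 V)).compr₂
    (TensorPower.mulEquiv (R := F) (M := V) (n := n) (m := 1)).toLinearMap).compl₂
      (PiTensorProduct.subsingletonEquiv (R := F) (s := fun _ : Fin 1 => V)
        (0 : Fin 1)).symm.toLinearMap

theorem snocMap_tprod {F : Type*} [Field F] {V : Type*} [AddCommGroup V] [Module F V] (n : ℕ)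
    (x : Fin n → V) (v : V) :
    snocMap F V n (tprod F x) v = tprod F (Fin.snoc (α := fun _ => V) x v) := by
  have h := TensorPower.tprod_mul_tprod F x (fun _ : Fin 1 => v)
  rw [TensorPower.gMul_def] at h
  have e : (PiTensorProduct.subsingletonEquiv (R := F) (s := fun _ : Fin 1 => V)
        (0 : Fin 1)).symm v = tprod F (fun _ : Fin 1 => v) :=
    PiTensorProduct.subsingletonEquiv_symm_apply' (R := F) (0 : Fin 1) v
  have g : snocMap F V n (tprod F x) v =
      TensorPower.mulEquiv ((tprod F x) ⊗ₜ[F]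
        ((PiTensorProduct.subsingletonEquiv (R := F) (s := fun _ : Fin 1 => V)
          (0 : Fin 1)).symm v)) := rfl
  rw [g, e, h]
  congr 1
  rw [Fin.append_right_eq_snoc]

theorem snocMap_repr {F : Type*} [Field F] {V : Type*} [AddCommGroup V] [Module F V] {κ : Type*}
    (b : Basis κ F V) (n : ℕ) (x : ⨂[F]^n V) (v : V) (β : Fin (n + 1) → κ) :
    (Basis.piTensorProduct (fun _ : Fin (n + 1) => b)).repr (snocMap F V n x v) β =
      (Basis.piTensorProduct (fun _ : Fin n => b)).repr x (fun m => β m.castSucc) *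
        b.repr v (β (Fin.last n)) := by
  induction x using PiTensorProduct.induction_on with
  | add x y hx hy => simp only [map_add, LinearMap.add_apply, Finsupp.add_apply, hx, hy, add_mul]
  | smul_tprod r x =>
    simp only [map_smul, LinearMap.smul_apply, Finsupp.smul_apply, snocMap_tprod,
      Basis.piTensorProduct_repr_tprod_apply, smul_eq_mul, Fin.prod_univ_castSucc,
      Fin.snoc_castSucc, Fin.snoc_last]
    ring

section AnyOrder

variable {F : Type*} [Field F] {ι : Type*} {V : ι → Type*}
  [∀ i, AddCommGroup (V i)] [∀ i, Module F (V i)]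

/-- The tensor power `t^{⊗n}` of a tensor `t ∈ ⨂ᵢ Vᵢ`, regarded as a tensor of the same order in
`⨂ᵢ (Vᵢ^{⊗n})`. -/
def tensorPow (t : ⨂[F] i, V i) : (n : ℕ) → ⨂[F] i, (⨂[F]^n (V i))
  | 0 => tprod F (fun _ => tprod F Fin.elim0)
  | n + 1 => PiTensorProduct.map₂ (fun i => snocMap F (V i) n) (tensorPow t n) t

/-- In coordinates, `t^{⊗n}` has entries `∏ₘ t(α₁ₘ, …, αₖₘ)`. -/
theorem tensorPow_repr [Fintype ι] {κ : ι → Type*} (b : ∀ i, Basis (κ i) F (V i))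
    (t : ⨂[F] i, V i) (n : ℕ) (α : ∀ i, Fin n → κ i) :
    (Basis.piTensorProduct (fun i => Basis.piTensorProduct (fun _ : Fin n => b i))).repr
      (tensorPow t n) α = ∏ m : Fin n, (Basis.piTensorProduct b).repr t (fun i => α i m) := by
  induction n with
  | zero =>
    simp only [tensorPow, Finset.univ_eq_empty, Finset.prod_empty]
    rw [Basis.piTensorProduct_repr_tprod_apply]
    refine Finset.prod_eq_one fun i _ => ?_
    rw [Basis.piTensorProduct_repr_tprod_apply]
    simp
  | succ n ih =>
    rw [Fin.prod_univ_castSucc, ← ih (fun i m => α i m.castSucc)]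
    simp only [tensorPow]
    generalize tensorPow t n = s
    clear ih
    induction s using PiTensorProduct.induction_on with
    | add x y hx hy => simp [add_mul, hx, hy]
    | smul_tprod r x =>
      induction t using PiTensorProduct.induction_on with
      | add u v hu hv => simp only [map_add, Finsupp.add_apply, hu, hv, mul_add]
      | smul_tprod q y =>
        simp only [map_smul, LinearMap.smul_apply, Finsupp.smul_apply, map₂_tprod_tprod,
          Basis.piTensorProduct_repr_tprod_apply, snocMap_repr, smul_eq_mul,
          Finset.prod_mul_distrib]
        ring

/-- The support of a tensor with respect to a tuple of bases. -/
def tensorSupport {κ : ι → Type*} [Finite ι] (b : ∀ i, Basis (κ i) F (V i)) (t : ⨂[F] i, V i) :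
    Set (∀ i, κ i) :=
  {α | (Basis.piTensorProduct b).repr t α ≠ 0}

/-- A set `Φ ⊆ ∏ᵢ Iᵢ` is tight if there are injective maps `uᵢ : Iᵢ → ℤ` such that
`∑ᵢ uᵢ(αᵢ) = 0` for all `α ∈ Φ`. -/
def IsTightSet [Fintype ι] {I : ι → Type*} (Φ : Set (∀ i, I i)) : Prop :=
  ∃ u : ∀ i, I i → ℤ, (∀ i, Function.Injective (u i)) ∧ ∀ α ∈ Φ, ∑ i, u i (α i) = 0

/-- A tensor is tight if its support with respect to some tuple of bases is tight. -/
def IsTight [Fintype ι] (t : ⨂[F] i, V i) : Prop :=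
  ∃ b : ∀ i, Basis (Fin (finrank F (V i))) F (V i), IsTightSet (tensorSupport b t)

/-- The tensor `t` restricts to the tensor `s`: there are linear maps `Aᵢ : Vᵢ → Wᵢ` with
`s = (A₁ ⊗ ⋯ ⊗ Aₖ) t`. -/
def Restricts {W : ι → Type*} [∀ i, AddCommGroup (W i)] [∀ i, Module F (W i)]
    (t : ⨂[F] i, V i) (s : ⨂[F] i, W i) : Prop :=
  ∃ A : ∀ i, V i →ₗ[F] W i, PiTensorProduct.map A t = s

variable (F ι) in
/-- The unit tensor `⟨r⟩ = ∑ⱼ eⱼ ⊗ ⋯ ⊗ eⱼ ∈ ⨂ᵢ F^r`. -/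
def unitTensor (r : ℕ) : ⨂[F] _ : ι, (Fin r → F) :=
  ∑ j : Fin r, tprod F (fun _ => Pi.single j 1)

/-- The subrank of `t`: the largest `r` such that `t` restricts to `⟨r⟩`. -/
def subrank (t : ⨂[F] i, V i) : ℕ :=
  sSup {r : ℕ | Restricts t (unitTensor F ι r)}

end AnyOrder

section Slices

variable {F : Type*} [Field F] {k : ℕ} {V : Fin (k + 1) → Type*}
  [∀ i, AddCommGroup (V i)] [∀ i, Module F (V i)]

/-- The tensor `v ⊗ w` with `v ∈ Vⱼ` inserted at position `j` of `w ∈ ⨂_{i ≠ j} Vᵢ`; here the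
indices `i ≠ j` are enumerated in increasing order by `j.succAbove` (see `insertAt_tprod`). -/
def insertAt (j : Fin (k + 1)) (v : V j) (w : ⨂[F] i, V (j.succAbove i)) : ⨂[F] i, V i :=
  PiTensorProduct.lift ((PiTensorProduct.tprod F).curryMid j v) w

theorem insertAt_tprod (j : Fin (k + 1)) (v : V j) (x : ∀ i, V (j.succAbove i)) :
    insertAt j v (PiTensorProduct.tprod F x) = PiTensorProduct.tprod F (j.insertNth v x) := by
  simp [insertAt]

/-- A slice is a tensor of the form `v ⊗ w` with `v ∈ Vⱼ` and `w ∈ ⨂_{i ≠ j} Vᵢ` for some `j`. -/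
def IsSlice (t : ⨂[F] i, V i) : Prop :=
  ∃ (j : Fin (k + 1)) (v : V j) (w : ⨂[F] i, V (j.succAbove i)), t = insertAt j v w

/-- The slice rank of `t`: the smallest `r` such that `t` is a sum of `r` slices. -/
def sliceRank (t : ⨂[F] i, V i) : ℕ :=
  sInf {r : ℕ | ∃ s : Fin r → ⨂[F] i, V i, (∀ l, IsSlice (s l)) ∧ t = ∑ l, s l}

end Slices

end TensorRanks

end

/-!
The asymptotic slice rank of a tight tensor equals its asymptotic subrank because both are governed
by one combinatorial quantity. Let `Φ` be the support of `t` in bases that witness tightness, and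
let `N n` be the maximum over `α ∈ Φⁿ` of the size of the smallest of the type classes of
`α₀, α₁, α₂` (`maxMinTypeClass`). Concatenation of words shows `N m * N n ≤ N (m + n)`, so
`log (N n) / n` converges by Fekete's lemma.

*Upper bound.* By definition of `N n`, every position in the support of `t^{⊗n}` has a coordinate
in a type class of size at most `N n`. There are polynomially many types, so polynomially many times
`N n` coordinate hyperplanes cover the support, which bounds the slice rank
(`sliceRank_tensorPow_le`).

*Comparison.* The subrank is at most the slice rank, since a decomposition of the unit tensor `⟨r⟩`
into slices has at least `r` terms (`le_of_diagonal_eq_sum_slices`).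

*Lower bound.* Let `Ψ` be the set of all elements of `Φⁿ` whose coordinates lie in the type classes
of a maximizer `α`. It is invariant under the symmetric group, which acts transitively on each type
class, so all words of a type class are coordinates of equally many elements of `Ψ`. Tightness
provides linear hashes of the three coordinates modulo a prime `p` that add up to zero on `Φⁿ`. If
`p` is a large constant times the number of elements of `Ψ` with a given coordinate, then for
suitable weights at least half of `Ψ` is free of collisions (`exists_weights`). Keeping those
elements whose hashes, suitably translated, are `x, x, -2x` with `x` in a set without 3-term
progressions leaves a matching (`exists_matching_of_prime`), to the size of which `t^{⊗n}` restricts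
(`le_subrank_of_matching`). With Behrend's progression-free sets, only a factor `exp (O(√n))` is
lost against `N n` (`exists_large_matching`).
-/

namespace TensorRanks

open Module PiTensorProduct

/-! ### Slices in coordinates -/

section Slices

variable {F : Type*} [Field F] {k : ℕ} {V : Fin (k + 1) → Type*}
  [∀ i, AddCommGroup (V i)] [∀ i, Module F (V i)]

theorem insertAt_repr {κ : Fin (k + 1) → Type*} (b : ∀ i, Basis (κ i) F (V i))
    (j : Fin (k + 1)) (v : V j) (w : ⨂[F] i, V (j.succAbove i)) (α : ∀ i, κ i) :
    (Basis.piTensorProduct b).repr (insertAt j v w) α =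
      (b j).repr v (α j) * (Basis.piTensorProduct fun i => b (j.succAbove i)).repr w
        (fun i => α (j.succAbove i)) := by
  induction w using PiTensorProduct.induction_on with
  | add x y hx hy =>
    have : insertAt j v (x + y) = insertAt j v x + insertAt j v y := map_add _ _ _
    simp only [this, map_add, Finsupp.add_apply, hx, hy, mul_add]
  | smul_tprod r x =>
    have : insertAt j v (r • tprod F x) = r • insertAt j v (tprod F x) := map_smul _ _ _
    simp only [this, insertAt_tprod, map_smul, Finsupp.smul_apply,
      Basis.piTensorProduct_repr_tprod_apply, smul_eq_mul, Fin.prod_univ_succAbove _ j,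
      Fin.insertNth_apply_same, Fin.insertNth_apply_succAbove]
    ring

theorem map_insertAt {W : Fin (k + 1) → Type*} [∀ i, AddCommGroup (W i)] [∀ i, Module F (W i)]
    (A : ∀ i, V i →ₗ[F] W i) (j : Fin (k + 1)) (v : V j) (w : ⨂[F] i, V (j.succAbove i)) :
    PiTensorProduct.map A (insertAt j v w) =
      insertAt j (A j v) (PiTensorProduct.map (fun i => A (j.succAbove i)) w) := by
  induction w using PiTensorProduct.induction_on with
  | add x y hx hy =>
    have h1 : insertAt j v (x + y) = insertAt j v x + insertAt j v y := map_add _ _ _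
    rw [h1, map_add, hx, hy, map_add]
    exact (map_add _ _ _).symm
  | smul_tprod r x =>
    have h1 : insertAt j v (r • tprod F x) = r • insertAt j v (tprod F x) := map_smul _ _ _
    have h2 : ∀ y, insertAt j (A j v) (r • y) = r • insertAt j (A j v) y :=
      fun y => map_smul _ _ _
    rw [h1, map_smul, map_smul, h2, map_tprod, insertAt_tprod, insertAt_tprod, map_tprod]
    congr 2
    ext i
    refine Fin.succAboveCases j ?_ (fun i => ?_) i <;> simp

theorem sliceRank_le_card {t : ⨂[F] i, V i} {X : Type*} [Fintype X] (s : X → ⨂[F] i, V i)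
    (hs : ∀ x, IsSlice (s x)) (ht : t = ∑ x, s x) : sliceRank t ≤ Fintype.card X :=
  Nat.sInf_le ⟨fun l => s ((Fintype.equivFin X).symm l), fun _ => hs _, by
    rw [ht, Equiv.sum_comp (Fintype.equivFin X).symm s]⟩

variable {κ : Fin (k + 1) → Type*} [∀ i, Fintype (κ i)]

theorem exists_slices_of_support_covered [∀ i, DecidableEq (κ i)] (b : ∀ i, Basis (κ i) F (V i))
    (t : ⨂[F] i, V i) (A : ∀ i, Finset (κ i))
    (hA : ∀ α ∈ tensorSupport b t, ∃ i, α i ∈ A i) :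
    ∃ s : (Σ i, A i) → ⨂[F] i, V i, (∀ x, IsSlice (s x)) ∧ t = ∑ x, s x := by
  classical
  set c := (Basis.piTensorProduct b).repr t
  have hA' : ∀ α, ∃ i, c α ≠ 0 → α i ∈ A i := fun α => by
    by_cases h : c α = 0
    · exact ⟨0, fun h' => (h' h).elim⟩
    · obtain ⟨i, hi⟩ := hA α h
      exact ⟨i, fun _ => hi⟩
  choose f hf using hA'
  refine ⟨fun x => ∑ α with f α = x.1 ∧ α x.1 = x.2.1, c α • Basis.piTensorProduct b α,
    fun x => ?_, ?_⟩
  · refine ⟨x.1, b x.1 x.2.1, ∑ α with f α = x.1 ∧ α x.1 = x.2.1,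
      c α • tprod F (fun i => b (x.1.succAbove i) (α (x.1.succAbove i))), ?_⟩
    have h1 : ∀ w, insertAt x.1 (b x.1 x.2.1) w =
      PiTensorProduct.lift ((PiTensorProduct.tprod F).curryMid x.1 (b x.1 x.2.1)) w :=
      fun _ => rfl
    rw [h1, map_sum]
    refine Finset.sum_congr rfl fun α hα => ?_
    rw [map_smul, ← h1, insertAt_tprod, Basis.piTensorProduct_apply]
    congr 2
    ext i
    refine Fin.succAboveCases x.1 ?_ (fun i => ?_) i
    · simp [(Finset.mem_filter.1 hα).2.2]
    · simp
  · have h2 : t = ∑ α, c α • Basis.piTensorProduct b α :=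
      ((Basis.piTensorProduct b).sum_repr t).symm
    rw [h2]
    simp_rw [Finset.sum_filter]
    rw [Finset.sum_comm]
    refine Finset.sum_congr rfl fun α _ => ?_
    by_cases h : c α = 0
    · simp [h]
    · rw [Finset.sum_eq_single (⟨f α, ⟨α (f α), hf α h⟩⟩ : Σ i, A i)]
      · simp
      · rintro ⟨i, a, ha⟩ - hne
        refine if_neg ?_
        rintro ⟨rfl, ha'⟩
        exact hne (Sigma.ext rfl (heq_of_eq (Subtype.ext ha'.symm)))
      · simp

/-- If the coordinate hyperplanes `αᵢ = a`, `a ∈ Aᵢ`, cover the support of `t`, then the slice rank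
of `t` is at most the number of these hyperplanes. -/
theorem sliceRank_le_of_support_covered [∀ i, DecidableEq (κ i)] (b : ∀ i, Basis (κ i) F (V i))
    (t : ⨂[F] i, V i) (A : ∀ i, Finset (κ i))
    (hA : ∀ α ∈ tensorSupport b t, ∃ i, α i ∈ A i) :
    sliceRank t ≤ ∑ i, (A i).card := by
  obtain ⟨s, hs, h⟩ := exists_slices_of_support_covered b t A hA
  simpa using sliceRank_le_card s hs h

/-- The slice rank is attained, as the set of which it is the infimum is nonempty. -/
theorem exists_slices_sliceRank (b : ∀ i, Basis (κ i) F (V i)) (t : ⨂[F] i, V i) :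
    ∃ s : Fin (sliceRank t) → ⨂[F] i, V i, (∀ l, IsSlice (s l)) ∧ t = ∑ l, s l := by
  classical
  obtain ⟨s, hs, h⟩ := exists_slices_of_support_covered b t (fun _ => Finset.univ)
    (fun _ _ => ⟨0, Finset.mem_univ _⟩)
  refine Nat.sInf_mem (s := {r : ℕ | ∃ s : Fin r → ⨂[F] i, V i, (∀ l, IsSlice (s l)) ∧
    t = ∑ l, s l}) ⟨_, fun l => s ((Fintype.equivFin _).symm l), fun _ => hs _, ?_⟩
  rw [h, Equiv.sum_comp (Fintype.equivFin _).symm s]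

end Slices

/-! ### The slice rank of the unit tensor -/

section UnitTensor

variable {F : Type*} [Field F]

theorem exists_ne_zero_of_card_lt {X Y : Type*} [Fintype X] [Fintype Y] (L : X → Y → F)
    (h : Fintype.card X < Fintype.card Y) : ∃ y : Y → F, y ≠ 0 ∧ ∀ l, ∑ c, y c * L l c = 0 := by
  have h1 : LinearMap.ker (Matrix.of L).mulVecLin ≠ ⊥ :=
    LinearMap.ker_ne_bot_of_finrank_lt (by simpa using h)
  obtain ⟨y, hy, hy0⟩ := Submodule.exists_mem_ne_zero_of_ne_bot h1
  refine ⟨y, hy0, fun l => ?_⟩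
  have := congrFun (LinearMap.mem_ker.1 hy) l
  simpa [Matrix.mulVec, dotProduct, mul_comm] using this

/-- A subspace of `F^Y` cut out by `|X|` equations contains a vector with at least `|Y| - |X|`
nonzero coordinates. -/
theorem exists_large_support {X Y : Type*} [Fintype X] [Fintype Y] [DecidableEq F]
    (L : X → Y → F) :
    ∃ x : Y → F, (∀ l, ∑ c, x c * L l c = 0) ∧
      Fintype.card Y ≤ Fintype.card X + (Finset.univ.filter fun c => x c ≠ 0).card := by
  classical
  let P : ℕ → Prop := fun m => ∃ x : Y → F, (∀ l, ∑ c, x c * L l c = 0) ∧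
    (Finset.univ.filter fun c => x c ≠ 0).card = m
  have hP0 : P 0 := ⟨0, by simp, by simp⟩
  -- A solution of largest support works: otherwise some nonzero solution vanishes on its support,
  -- and adding it enlarges the support.
  have hPm : P (Nat.findGreatest P (Fintype.card Y)) :=
    Nat.findGreatest_spec (Nat.zero_le _) hP0
  obtain ⟨x, hx, hxm⟩ := hPm
  refine ⟨x, hx, ?_⟩
  by_contra! hlt
  obtain ⟨y, hy0, hy⟩ := exists_ne_zero_of_card_lt
    (X := X ⊕ (Finset.univ.filter fun c => x c ≠ 0))
    (Sum.elim L (fun a => Pi.single a.1 1)) (by rwa [Fintype.card_sum, Fintype.card_coe])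
  have hyx : ∀ c, x c ≠ 0 → y c = 0 := fun c hc => by
    have := hy (Sum.inr ⟨c, by simpa using hc⟩)
    simpa [Pi.single_apply] using this
  obtain ⟨c₀, hc₀⟩ : ∃ c, y c ≠ 0 := by
    by_contra! h
    exact hy0 (funext h)
  have hP : P (Finset.univ.filter fun c => (x + y) c ≠ 0).card := by
    refine ⟨x + y, fun l => ?_, rfl⟩
    have := hy (Sum.inl l)
    simp only [Sum.elim_inl] at this
    simp [add_mul, Finset.sum_add_distrib, hx l, this]
  have h1 := Nat.le_findGreatest (Finset.card_le_univ _) hP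
  rw [← hxm] at h1
  refine h1.not_gt (Finset.card_lt_card ⟨fun c hc => ?_, fun hsub => ?_⟩)
  · have hc' : x c ≠ 0 := by simpa using hc
    simp [hyx c hc', hc']
  · have hx0 : x c₀ = 0 := by
      by_contra h
      exact hc₀ (hyx c₀ h)
    have := hsub (show c₀ ∈ Finset.univ.filter fun c => (x + y) c ≠ 0 by simp [hx0, hc₀])
    simp [hx0] at this

/-- A decomposition of the `r × r × r` diagonal tensor into `s` slices forces `r ≤ s`. Contracting
the third factor with a vector `x` that annihilates the slices in that direction leaves a diagonal
matrix with many nonzero entries, and contracting it with a vector `y` that annihilates the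
remaining slices and is supported on these entries gives a contradiction if `s < r`. -/
theorem le_of_diagonal_eq_sum_slices {r s : ℕ} (j : Fin s → Fin 3) (v : Fin s → Fin r → F)
    (w : Fin s → (Fin 2 → Fin r) → F)
    (h : ∀ a b c : Fin r, (if a = b ∧ b = c then (1 : F) else 0) =
      ∑ l, v l (![a, b, c] (j l)) * w l (fun i => ![a, b, c] ((j l).succAbove i))) :
    r ≤ s := by
  classical
  by_contra! hlt
  obtain ⟨x, hx, hxc⟩ := exists_large_support (fun l : {l // j l = 2} => v l.1)
  set A := Finset.univ.filter fun c => x c ≠ 0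
  obtain ⟨y, hy0, hy⟩ := exists_ne_zero_of_card_lt
    (X := {l // ¬ j l = 2} ⊕ (Aᶜ : Finset (Fin r)))
    (Sum.elim (fun l => if j l.1 = 0 then v l.1 else fun a => ∑ c, x c * w l.1 ![a, c])
      (fun a => Pi.single a.1 1)) (by
      have h1 := Fintype.card_subtype_compl (fun l : Fin s => j l = 2)
      have h2 := Fintype.card_subtype_le (fun l : Fin s => j l = 2)
      have h3 := Finset.card_compl A
      have h4 := Finset.card_le_univ A
      simp only [Fintype.card_sum, Fintype.card_coe, Fintype.card_fin] at *
      omega)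
  have hyx : ∀ c, x c = 0 → y c = 0 := fun c hc => by
    have := hy (Sum.inr ⟨c, by simpa [A] using hc⟩)
    simpa [Pi.single_apply] using this
  refine hy0 (funext fun b => ?_)
  by_contra hb
  have hxb : x b ≠ 0 := fun h0 => hb (hyx b h0)
  have key : ∑ a, ∑ c, y a * x c * (if a = b ∧ b = c then (1 : F) else 0) = y b * x b := by
    rw [Finset.sum_eq_single b, Finset.sum_eq_single b] <;> simp +contextual [eq_comm]
  simp_rw [h, Finset.mul_sum] at key
  have hz : ∑ a, ∑ c, ∑ l, y a * x c * (v l (![a, b, c] (j l)) *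
      w l (fun i => ![a, b, c] ((j l).succAbove i))) = 0 := by
    have h3 : ∀ a, (∑ c, ∑ l, y a * x c * (v l (![a, b, c] (j l)) *
      w l (fun i => ![a, b, c] ((j l).succAbove i)))) = ∑ l, ∑ c, y a * x c *
        (v l (![a, b, c] (j l)) * w l (fun i => ![a, b, c] ((j l).succAbove i))) :=
      fun a => Finset.sum_comm
    simp_rw [h3]
    rw [Finset.sum_comm]
    refine Finset.sum_eq_zero fun l _ => ?_
    have e0 : ∀ a c : Fin r, (fun i => ![a, b, c] ((0 : Fin 3).succAbove i)) = ![b, c] :=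
      fun a c => by ext i; fin_cases i <;> rfl
    have e1 : ∀ a c : Fin r, (fun i => ![a, b, c] ((1 : Fin 3).succAbove i)) = ![a, c] :=
      fun a c => by ext i; fin_cases i <;> rfl
    have e2 : ∀ a c : Fin r, (fun i => ![a, b, c] ((2 : Fin 3).succAbove i)) = ![a, b] :=
      fun a c => by ext i; fin_cases i <;> rfl
    obtain hl | hl | hl : j l = 0 ∨ j l = 1 ∨ j l = 2 := by
      generalize j l = i
      fin_cases i <;> simp
    · have := hy (Sum.inl ⟨l, by rw [hl]; decide⟩)
      simp only [Sum.elim_inl, hl, if_true] at this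
      simp_rw [hl, e0]
      rw [Finset.sum_comm]
      refine Finset.sum_eq_zero fun c _ => ?_
      calc _ = x c * w l ![b, c] * ∑ a, y a * v l a := by
            rw [Finset.mul_sum]
            exact Finset.sum_congr rfl fun a _ => by simp; ring
        _ = 0 := by rw [this, mul_zero]
    · have := hy (Sum.inl ⟨l, by rw [hl]; decide⟩)
      simp only [Sum.elim_inl, hl, one_ne_zero, if_false] at this
      simp_rw [hl, e1]
      calc _ = v l b * ∑ a, y a * ∑ c, x c * w l ![a, c] := by
            simp_rw [Finset.mul_sum]
            exact Finset.sum_congr rfl fun a _ => Finset.sum_congr rfl fun c _ => by simp; ring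
        _ = 0 := by rw [this, mul_zero]
    · have := hx ⟨l, hl⟩
      simp only at this
      simp_rw [hl, e2]
      refine Finset.sum_eq_zero fun a _ => ?_
      calc _ = y a * w l ![a, b] * ∑ c, x c * v l c := by
            rw [Finset.mul_sum]
            exact Finset.sum_congr rfl fun c _ => by simp; ring
        _ = 0 := by rw [this, mul_zero]
  rw [hz] at key
  exact mul_ne_zero hb hxb key.symm

theorem unitTensor_repr {ι : Type*} [Fintype ι] (r : ℕ) (α : ι → Fin r) :
    (Basis.piTensorProduct (fun _ : ι => Pi.basisFun F (Fin r))).repr (unitTensor F ι r) α =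
      ∑ k : Fin r, ∏ i, if α i = k then (1 : F) else 0 := by
  simp only [unitTensor, map_sum, Finsupp.coe_finsetSum, Finset.sum_apply,
    Basis.piTensorProduct_repr_tprod_apply, Pi.basisFun_repr, Pi.single_apply]

theorem unitTensor_three_repr (r : ℕ) (a b c : Fin r) :
    (Basis.piTensorProduct (fun _ : Fin 3 => Pi.basisFun F (Fin r))).repr
      (unitTensor F (Fin 3) r) ![a, b, c] = if a = b ∧ b = c then (1 : F) else 0 := by
  rw [unitTensor_repr]
  simp only [Fin.prod_univ_three]
  rw [Finset.sum_eq_single a]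
  · by_cases h1 : a = b
    · subst h1
      simp [eq_comm]
    · simp [h1, eq_comm]
  · intro k _ hk
    simp [hk.symm]
  · simp

variable {V : Fin 3 → Type*} [∀ i, AddCommGroup (V i)] [∀ i, Module F (V i)]

theorem le_sliceRank_of_restricts [∀ i, FiniteDimensional F (V i)] (t : ⨂[F] i, V i) {r : ℕ}
    (h : Restricts t (unitTensor F (Fin 3) r)) : r ≤ sliceRank t := by
  obtain ⟨A, hA⟩ := h
  obtain ⟨s, hs, ht⟩ := exists_slices_sliceRank (fun i => Module.finBasis F (V i)) t
  choose j v w hw using hs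
  refine le_of_diagonal_eq_sum_slices j (fun l => A (j l) (v l))
    (fun l => (Basis.piTensorProduct (fun _ : Fin 2 => Pi.basisFun F (Fin r))).repr
      (PiTensorProduct.map (fun i => A ((j l).succAbove i)) (w l))) fun a b c => ?_
  rw [← unitTensor_three_repr, ← hA]
  conv_lhs => rw [ht]
  simp only [map_sum, Finsupp.coe_finsetSum, Finset.sum_apply]
  refine Finset.sum_congr rfl fun l _ => ?_
  rw [hw l, map_insertAt, insertAt_repr (fun _ => Pi.basisFun F (Fin r)), Pi.basisFun_repr]

theorem subrank_le_sliceRank [∀ i, FiniteDimensional F (V i)] (t : ⨂[F] i, V i) :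
    subrank t ≤ sliceRank t :=
  csSup_le' fun _ hr => le_sliceRank_of_restricts t hr

/-- A family of positions in the support of `t` such that no other support position can be
composed from the coordinates of members of the family gives a restriction of `t` to a unit
tensor, namely the projection to these coordinates, rescaled. -/
theorem le_subrank_of_matching [∀ i, FiniteDimensional F (V i)] {κ : Fin 3 → Type*}
    (b : ∀ i, Basis (κ i) F (V i)) (t : ⨂[F] i, V i) {r : ℕ} (S : Fin r → ∀ i, κ i)
    (hS : ∀ l, S l ∈ tensorSupport b t)
    (hind : ∀ l : Fin 3 → Fin r, (fun i => S (l i) i) ∈ tensorSupport b t →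
      l 0 = l 1 ∧ l 1 = l 2) :
    r ≤ subrank t := by
  refine le_csSup ⟨sliceRank t, fun _ hr => le_sliceRank_of_restricts t hr⟩ ?_
  let d : Fin 3 → Fin r → F :=
    ![fun l => ((Basis.piTensorProduct b).repr t (S l))⁻¹, fun _ => 1, fun _ => 1]
  let A : ∀ i, V i →ₗ[F] (Fin r → F) := fun i =>
    LinearMap.pi fun l => d i l • (b i).coord (S l i)
  have hA : ∀ (s : ⨂[F] i, V i) (l : Fin 3 → Fin r),
      (Basis.piTensorProduct (fun _ : Fin 3 => Pi.basisFun F (Fin r))).repr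
        (PiTensorProduct.map A s) l =
      (∏ i, d i (l i)) * (Basis.piTensorProduct b).repr s (fun i => S (l i) i) := by
    intro s l
    induction s using PiTensorProduct.induction_on with
    | add x y hx hy => simp only [map_add, Finsupp.add_apply, hx, hy, mul_add]
    | smul_tprod q x =>
      simp only [map_smul, map_tprod, Finsupp.smul_apply,
        Basis.piTensorProduct_repr_tprod_apply, smul_eq_mul, Pi.basisFun_repr, A,
        LinearMap.pi_apply, LinearMap.smul_apply, Basis.coord_apply, Finset.prod_mul_distrib]
      ring
  refine ⟨A, (Basis.piTensorProduct (fun _ : Fin 3 => Pi.basisFun F (Fin r))).repr.injective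
    (Finsupp.ext fun l => ?_)⟩
  have hl : l = ![l 0, l 1, l 2] := by ext i; fin_cases i <;> rfl
  rw [hA]
  conv_rhs => rw [hl, unitTensor_three_repr]
  split_ifs with h
  · have hl' : (fun i => S (l i) i) = S (l 0) := by
      ext i
      fin_cases i
      · rfl
      · simp [h.1]
      · simp [h.1, h.2]
    rw [hl']
    simp only [d, Fin.prod_univ_three, Matrix.cons_val, mul_one]
    exact inv_mul_cancel₀ (hS (l 0))
  · have : (Basis.piTensorProduct b).repr t (fun i => S (l i) i) = 0 := by
      by_contra h0
      exact h (hind l h0)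
    rw [this, mul_zero]

end UnitTensor

/-! ### Type classes of words -/

section TypeClass

variable {I : Type*} [Fintype I] [DecidableEq I] {n : ℕ}

/-- The type class of a word `a` of length `n`: all words in which every letter occurs as often as
in `a`. -/
def typeClass (a : Fin n → I) : Finset (Fin n → I) :=
  Finset.univ.filter fun b => ∀ c, (Finset.univ.filter fun m => b m = c).card =
    (Finset.univ.filter fun m => a m = c).card

theorem mem_typeClass {a b : Fin n → I} :
    b ∈ typeClass a ↔ ∀ c, (Finset.univ.filter fun m => b m = c).card =
      (Finset.univ.filter fun m => a m = c).card := by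
  simp [typeClass]

theorem self_mem_typeClass (a : Fin n → I) : a ∈ typeClass a :=
  mem_typeClass.2 fun _ => rfl

theorem card_typeClass_pos (a : Fin n → I) : 0 < (typeClass a).card :=
  Finset.card_pos.2 ⟨a, self_mem_typeClass a⟩

theorem comp_perm_mem_typeClass {a b : Fin n → I} (h : b ∈ typeClass a)
    (σ : Equiv.Perm (Fin n)) : b ∘ σ ∈ typeClass a :=
  mem_typeClass.2 fun c => by
    rw [← mem_typeClass.1 h c]
    exact Finset.card_bij (fun m _ => σ m) (by simp) (by simp)
      (fun m hm => ⟨σ.symm m, by simpa using hm, by simp⟩)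

/-- The symmetric group acts transitively on a type class. -/
theorem exists_perm_of_mem_typeClass {a b : Fin n → I} (h : b ∈ typeClass a) :
    ∃ σ : Equiv.Perm (Fin n), b = a ∘ σ := by
  have e : ∀ c, Nonempty ({m // b m = c} ≃ {m // a m = c}) := fun c =>
    ⟨Fintype.equivOfCardEq (by
      rw [Fintype.card_subtype, Fintype.card_subtype, mem_typeClass.1 h c])⟩
  exact ⟨Equiv.ofFiberEquiv fun c => (e c).some,
    funext fun m => (Equiv.ofFiberEquiv_map (fun c => (e c).some) m).symm⟩

/-- Words of length `n` have at most `(n + 1) ^ |I|` types, so few of them lie in small type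
classes. -/
theorem card_filter_typeClass_le (n N : ℕ) :
    (Finset.univ.filter fun a : Fin n → I => (typeClass a).card ≤ N).card ≤
      (n + 1) ^ Fintype.card I * N := by
  let f : (Fin n → I) → I → Fin (n + 1) := fun a c =>
    ⟨(Finset.univ.filter fun m => a m = c).card,
      Nat.lt_succ_of_le ((Finset.card_le_univ _).trans (by simp))⟩
  have h := Finset.card_le_mul_card_image_of_maps_to
    (s := Finset.univ.filter fun a : Fin n → I => (typeClass a).card ≤ N)
    (t := (Finset.univ : Finset (I → Fin (n + 1)))) (f := f) (by simp) N ?_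
  · simpa [mul_comm] using h
  · intro y _
    rcases Finset.eq_empty_or_nonempty
      ((Finset.univ.filter fun a : Fin n → I => (typeClass a).card ≤ N).filter
        fun a => f a = y) with h0 | ⟨a, ha⟩
    · simp [h0]
    · simp only [Finset.mem_filter, Finset.mem_univ, true_and] at ha
      refine (Finset.card_le_card fun b hb => ?_).trans ha.1
      simp only [Finset.mem_filter, Finset.mem_univ, true_and] at hb
      refine mem_typeClass.2 fun c => ?_
      have := congrFun (hb.2.trans ha.2.symm) c
      simpa [f] using this

theorem card_filter_append {I : Type*} [DecidableEq I] {n n' : ℕ} (a : Fin n → I)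
    (b : Fin n' → I) (c : I) :
    (Finset.univ.filter fun m => Fin.append a b m = c).card =
      (Finset.univ.filter fun m => a m = c).card +
        (Finset.univ.filter fun m => b m = c).card := by
  simp only [Finset.card_filter, Fin.sum_univ_add, Fin.append_left, Fin.append_right]

theorem card_typeClass_mul_le {n' : ℕ} (a : Fin n → I) (b : Fin n' → I) :
    (typeClass a).card * (typeClass b).card ≤ (typeClass (Fin.append a b)).card := by
  rw [← Finset.card_product]
  refine Finset.card_le_card_of_injOn (fun x => Fin.append x.1 x.2) (fun x hx => ?_) ?_
  · have hx' := Finset.mem_product.1 (Finset.mem_coe.1 hx)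
    refine Finset.mem_coe.2 (mem_typeClass.2 fun c => ?_)
    rw [card_filter_append, card_filter_append, mem_typeClass.1 hx'.1, mem_typeClass.1 hx'.2]
  · rintro ⟨x, y⟩ - ⟨x', y'⟩ - h
    have h' : Fin.append x y = Fin.append x' y' := h
    refine Prod.ext (funext fun m => ?_) (funext fun m => ?_)
    · simpa using congrFun h' (Fin.castAdd n' m)
    · simpa using congrFun h' (Fin.natAdd n m)

end TypeClass

/-! ### Linear hashing modulo a prime -/

section Hashing

variable {p : ℕ} [Fact p.Prime] {n : ℕ}

theorem mul_card_orthogonal_le {δ : Fin n → ZMod p} (hδ : δ ≠ 0) :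
    p * (Finset.univ.filter fun w : Fin n → ZMod p => ∑ m, w m * δ m = 0).card ≤ p ^ n := by
  obtain ⟨m₀, hm₀⟩ : ∃ m, δ m ≠ 0 := by
    by_contra! h
    exact hδ (funext h)
  -- Translates of the hyperplane along a coordinate axis on which `δ` does not vanish are disjoint.
  have key : ((Finset.univ : Finset (ZMod p)) ×ˢ
      (Finset.univ.filter fun w : Fin n → ZMod p => ∑ m, w m * δ m = 0)).card ≤
      (Finset.univ : Finset (Fin n → ZMod p)).card := by
    refine Finset.card_le_card_of_injOn (fun x => x.2 + Pi.single m₀ x.1) (by simp) ?_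
    rintro ⟨c, w⟩ hw ⟨c', w'⟩ hw' h
    have hw1 : ∑ m, w m * δ m = 0 := by simpa using hw
    have hw2 : ∑ m, w' m * δ m = 0 := by simpa using hw'
    have h' : w + Pi.single m₀ c = w' + Pi.single m₀ c' := h
    have hs : ∀ (w : Fin n → ZMod p) (c : ZMod p),
        ∑ m, (w + Pi.single m₀ c : Fin n → ZMod p) m * δ m =
        ∑ m, w m * δ m + c * δ m₀ := fun w c => by
      simp [add_mul, Finset.sum_add_distrib, Pi.single_apply]
    have h1 := hs w c
    rw [h', hs, hw1, hw2, zero_add, zero_add] at h1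
    have hc : c = c' := (mul_right_cancel₀ hm₀ h1).symm
    subst hc
    simpa using h'
  simpa [Finset.card_product, ZMod.card] using key

/-- For some pair of translations, at least the expected number of elements of `Ψ` have equal
translated hashes that lie in `X`. -/
theorem exists_shift {B : Type*} (Ψ : Finset B) (f g : B → ZMod p) (X : Finset (ZMod p)) :
    ∃ ρ σ : ZMod p, Ψ.card * X.card ≤
      p ^ 2 * (Ψ.filter fun β => f β + ρ = g β + σ ∧ f β + ρ ∈ X).card := by
  by_contra! h
  have h1 : ∑ x : ZMod p × ZMod p,
      (Ψ.filter fun β => f β + x.1 = g β + x.2 ∧ f β + x.1 ∈ X).card = Ψ.card * X.card := by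
    simp_rw [Finset.card_filter]
    rw [Finset.sum_comm, ← smul_eq_mul, ← Finset.sum_const]
    refine Finset.sum_congr rfl fun β _ => ?_
    rw [← Finset.card_filter]
    refine Finset.card_bij (fun x _ => f β + x.1) (fun x hx => ?_) ?_ ?_
    · exact (Finset.mem_filter.1 hx).2.2
    · rintro ⟨a, b⟩ hx ⟨a', b'⟩ hx' he
      simp only [Finset.mem_filter, Finset.mem_univ, true_and] at hx hx' he
      have ha : a = a' := add_left_cancel he
      subst ha
      have hb : b = b' := add_left_cancel (hx.1.symm.trans hx'.1)
      rw [hb]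
    · intro x hx
      exact ⟨(x - f β, x - g β), by simpa using hx, by simp⟩
  have h2 : ∑ x : ZMod p × ZMod p, p ^ 2 *
      (Ψ.filter fun β => f β + x.1 = g β + x.2 ∧ f β + x.1 ∈ X).card <
      ∑ _x : ZMod p × ZMod p, Ψ.card * X.card :=
    Finset.sum_lt_sum_of_nonempty Finset.univ_nonempty fun x _ => h x.1 x.2
  rw [← Finset.mul_sum, h1] at h2
  simp [ZMod.card, pow_two] at h2

/-- A set of integers in `[0, p / 2)` without 3-term progressions has none modulo `p` either. -/
theorem exists_progressionFree (p : ℕ) [Fact p.Prime] :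
    ∃ X : Finset (ZMod p), X.card = rothNumberNat (p / 2) ∧
      ∀ x ∈ X, ∀ y ∈ X, ∀ z ∈ X, x + y = 2 * z → x = z ∧ y = z := by
  obtain ⟨t, ht, hcard, hfree⟩ := rothNumberNat_spec (p / 2)
  have hlt : ∀ a ∈ t, a < p / 2 := fun a ha => Finset.mem_range.1 (ht ha)
  have hcast : ∀ a b : ℕ, a < p → b < p → (a : ZMod p) = b → a = b := fun a b ha hb h => by
    have := (ZMod.natCast_eq_natCast_iff' a b p).1 h
    rwa [Nat.mod_eq_of_lt ha, Nat.mod_eq_of_lt hb] at this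
  refine ⟨t.image (fun a : ℕ => (a : ZMod p)), ?_, ?_⟩
  · rw [Finset.card_image_of_injOn, hcard]
    intro a ha b hb h
    have h1 := hlt a ha
    have h2 := hlt b hb
    exact hcast a b (by omega) (by omega) h
  · intro x hx y hy z hz h
    obtain ⟨a, ha, rfl⟩ := Finset.mem_image.1 hx
    obtain ⟨b, hb, rfl⟩ := Finset.mem_image.1 hy
    obtain ⟨c, hc, rfl⟩ := Finset.mem_image.1 hz
    have h1 := hlt a ha
    have h2 := hlt b hb
    have h3 := hlt c hc
    have h4 : a + b = c + c := hcast _ _ (by omega) (by omega) (by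
      push_cast
      rw [h, two_mul])
    have h5 : a = c := hfree ha hc hb h4
    have h6 : b = c := by omega
    rw [h5, h6]
    exact ⟨rfl, rfl⟩

end Hashing

/-! ### Large matchings in powers of tight sets -/

section Matching

variable {κ : Fin 3 → Type*}

/-- The `n`-th power of `Φ ⊆ ∏ᵢ κᵢ`, as a subset of `∏ᵢ κᵢⁿ`. -/
def powSet (Φ : Set (∀ i, κ i)) (n : ℕ) : Set (∀ i, Fin n → κ i) :=
  {α | ∀ m, (fun i => α i m) ∈ Φ}

/-- The linear hash modulo `p`, with weights `w`, of a word over an alphabet that is labelled by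
integers. -/
def wordHash {p n : ℕ} {I : Type*} (u : I → ℤ) (w : Fin n → ZMod p) (a : Fin n → I) : ZMod p :=
  ∑ m, w m * (u (a m) : ZMod p)

variable [∀ i, Fintype (κ i)] [∀ i, DecidableEq (κ i)] {n : ℕ}

/-- All elements of a type class occur equally often as `i`-th coordinate in a set that is invariant
under permutations of the letter positions. -/
theorem card_fiber_mul_card_typeClass (Ψ : Finset (∀ i, Fin n → κ i)) (α : ∀ i, Fin n → κ i)
    (hT : ∀ β ∈ Ψ, ∀ i, β i ∈ typeClass (α i))
    (hperm : ∀ β ∈ Ψ, ∀ σ : Equiv.Perm (Fin n), (fun i => β i ∘ σ) ∈ Ψ)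
    (γ : ∀ i, Fin n → κ i) (hγ : γ ∈ Ψ) (i : Fin 3) :
    (Ψ.filter fun β => β i = γ i).card * (typeClass (α i)).card = Ψ.card := by
  rw [Finset.card_eq_sum_card_fiberwise (f := fun β => β i) (t := typeClass (α i))
    (fun β hβ => hT β hβ i), mul_comm, ← smul_eq_mul, ← Finset.sum_const]
  refine Finset.sum_congr rfl fun a ha => ?_
  obtain ⟨σ, hσ⟩ := exists_perm_of_mem_typeClass (a := γ i) (b := a) (mem_typeClass.2 fun c => by
    rw [mem_typeClass.1 ha, mem_typeClass.1 (hT γ hγ i)])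
  refine Finset.card_bij (fun β _ => fun i => β i ∘ σ) (fun β hβ => ?_) (fun β _ β' _ h => ?_)
    (fun β hβ => ?_)
  · rw [Finset.mem_filter] at hβ ⊢
    exact ⟨hperm β hβ.1 σ, by rw [hσ, ← hβ.2]⟩
  · funext i m
    simpa using congrFun (congrFun h i) (σ.symm m)
  · rw [Finset.mem_filter] at hβ
    refine ⟨fun i => β i ∘ σ.symm, Finset.mem_filter.2 ⟨hperm β hβ.1 _, ?_⟩, ?_⟩
    · have h : β i = γ i ∘ σ := hβ.2.trans hσ
      funext m
      simp [h]
    · funext i m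
      simp

/-- Some choice of weights leaves at least half of the elements of `Ψ` without a collision, that is,
without another element of `Ψ` with a common coordinate and the same hashes. -/
theorem exists_weights {p : ℕ} [Fact p.Prime] (u : ∀ i, κ i → ℤ)
    (hu : ∀ i, Function.Injective fun a => (u i a : ZMod p))
    (Ψ : Finset (∀ i, Fin n → κ i)) (T : ℕ)
    (hdeg : ∀ γ ∈ Ψ, ∀ i, (Ψ.filter fun β => β i = γ i).card * T ≤ Ψ.card)
    (hp : 6 * Ψ.card ≤ p * T) :
    ∃ w : Fin n → ZMod p, ∃ Ψ' ⊆ Ψ, Ψ.card ≤ 2 * Ψ'.card ∧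
      ∀ β ∈ Ψ', ∀ γ ∈ Ψ, (∃ i, γ i = β i) →
        (∀ i, wordHash (u i) w (γ i) = wordHash (u i) w (β i)) → γ = β := by
  classical
  by_contra! hcon
  let good : (Fin n → ZMod p) → (∀ i, Fin n → κ i) → Prop := fun w β =>
    ∀ γ ∈ Ψ, (∃ i, γ i = β i) →
      (∀ i, wordHash (u i) w (γ i) = wordHash (u i) w (β i)) → γ = β
  let P := (Ψ ×ˢ Ψ).filter fun x => x.1 ≠ x.2 ∧ ∃ i, x.2 i = x.1 i
  have hPT : P.card * T ≤ 3 * Ψ.card * Ψ.card := by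
    have h1 : P.card ≤ ∑ γ ∈ Ψ, ∑ i : Fin 3, (Ψ.filter fun β => β i = γ i).card := by
      rw [Finset.card_eq_sum_card_fiberwise (f := fun x => x.1) (s := P) (t := Ψ)
        (fun x hx => (Finset.mem_product.1 (Finset.mem_filter.1 hx).1).1)]
      refine Finset.sum_le_sum fun γ hγ => ?_
      have h2 : (P.filter fun x => x.1 = γ).card ≤
          ((Finset.univ : Finset (Fin 3)).biUnion fun i => Ψ.filter fun β => β i = γ i).card := by
        refine Finset.card_le_card_of_injOn (fun x => x.2) (fun x hx => ?_) ?_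
        · obtain ⟨hx1, hx2⟩ := Finset.mem_filter.1 hx
          obtain ⟨hx3, -, i, hi⟩ := Finset.mem_filter.1 hx1
          refine Finset.mem_coe.2 (Finset.mem_biUnion.2 ⟨i, Finset.mem_univ _,
            Finset.mem_filter.2 ⟨(Finset.mem_product.1 hx3).2, ?_⟩⟩)
          exact hi.trans (congrFun hx2 i)
        · intro x hx y hy h
          exact Prod.ext ((Finset.mem_filter.1 hx).2.trans (Finset.mem_filter.1 hy).2.symm) h
      exact h2.trans Finset.card_biUnion_le
    calc P.card * T ≤ (∑ γ ∈ Ψ, ∑ i : Fin 3, (Ψ.filter fun β => β i = γ i).card) * T :=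
          Nat.mul_le_mul_right _ h1
      _ = ∑ γ ∈ Ψ, ∑ i : Fin 3, (Ψ.filter fun β => β i = γ i).card * T := by
          simp_rw [Finset.sum_mul]
      _ ≤ ∑ γ ∈ Ψ, ∑ _i : Fin 3, Ψ.card :=
          Finset.sum_le_sum fun γ hγ => Finset.sum_le_sum fun i _ => hdeg γ hγ i
      _ = 3 * Ψ.card * Ψ.card := by simp; ring
  let bad : (Fin n → ZMod p) → Finset ((∀ i, Fin n → κ i) × (∀ i, Fin n → κ i)) := fun w =>
    P.filter fun x => ∀ i, wordHash (u i) w (x.2 i) = wordHash (u i) w (x.1 i)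
  have hbad : ∀ w, Ψ.card < 2 * (bad w).card := fun w => by
    have h1 : 2 * (Ψ.filter (good w)).card < Ψ.card := by
      by_contra! h
      obtain ⟨β, hβ, γ, hγ, hi, hh, hne⟩ := hcon w _ (Finset.filter_subset (good w) Ψ) h
      exact hne ((Finset.mem_filter.1 hβ).2 γ hγ hi hh)
    have h2 := Finset.card_filter_add_card_filter_not (s := Ψ) (good w)
    have h3 : (Ψ.filter fun β => ¬ good w β).card ≤ (bad w).card := by
      refine (Finset.card_le_card fun β hβ => ?_).trans
        (Finset.card_image_le (s := bad w) (f := fun x => x.1))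
      obtain ⟨hβ1, hβ2⟩ := Finset.mem_filter.1 hβ
      simp only [good] at hβ2
      push Not at hβ2
      obtain ⟨γ, hγ, hi, hh, hne⟩ := hβ2
      exact Finset.mem_image.2 ⟨(β, γ), Finset.mem_filter.2 ⟨Finset.mem_filter.2
        ⟨Finset.mem_product.2 ⟨hβ1, hγ⟩, hne.symm, hi⟩, hh⟩, rfl⟩
    omega
  have hsum : p * ∑ w, (bad w).card ≤ P.card * p ^ n := by
    simp_rw [bad, Finset.card_filter]
    rw [Finset.sum_comm, Finset.mul_sum, ← smul_eq_mul, ← Finset.sum_const]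
    refine Finset.sum_le_sum fun x hx => ?_
    rw [← Finset.card_filter]
    obtain ⟨-, hne, -⟩ := Finset.mem_filter.1 hx
    obtain ⟨j, hj⟩ := Function.ne_iff.1 hne
    obtain ⟨m, hm⟩ := Function.ne_iff.1 hj
    refine le_trans (Nat.mul_le_mul_left _ (Finset.card_le_card fun w hw => ?_))
      (mul_card_orthogonal_le (p := p)
        (δ := fun m => (u j (x.2 j m) : ZMod p) - (u j (x.1 j m) : ZMod p)) fun h0 => ?_)
    · have := (Finset.mem_filter.1 hw).2 j
      simp only [wordHash] at this
      simp [mul_sub, Finset.sum_sub_distrib, this]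
    · exact hm (hu j (sub_eq_zero.1 (congrFun h0 m)).symm)
  have hlt : ∑ _w : Fin n → ZMod p, Ψ.card < ∑ w, 2 * (bad w).card :=
    Finset.sum_lt_sum_of_nonempty Finset.univ_nonempty fun w _ => hbad w
  rw [← Finset.mul_sum, Finset.sum_const, smul_eq_mul, Finset.card_univ, Fintype.card_fun,
    ZMod.card, Fintype.card_fin] at hlt
  have hp0 : 0 < p := (Fact.out : p.Prime).pos
  have hT0 : 0 < T := by
    rcases Nat.eq_zero_or_pos T with h | h
    · have h0 : Ψ = ∅ := by
        rw [h] at hp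
        exact Finset.card_eq_zero.1 (by omega)
      have := hbad 0
      simp [bad, P, h0] at this
    · exact h
  have h1 : p * T * (p ^ n * Ψ.card) < p * T * (2 * ∑ w, (bad w).card) :=
    Nat.mul_lt_mul_of_pos_left hlt (Nat.mul_pos hp0 hT0)
  have h2 : 2 * T * (p * ∑ w, (bad w).card) ≤ 2 * T * (P.card * p ^ n) :=
    Nat.mul_le_mul_left _ hsum
  have h3 : 2 * p ^ n * (P.card * T) ≤ 2 * p ^ n * (3 * Ψ.card * Ψ.card) :=
    Nat.mul_le_mul_left _ hPT
  have h4 : p ^ n * Ψ.card * (6 * Ψ.card) ≤ p ^ n * Ψ.card * (p * T) :=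
    Nat.mul_le_mul_left _ hp
  nlinarith

/-- A large matching in the power of a tight set. It consists of the collision-free elements of `Ψ`
whose three hashes are `x`, `x`, `-2x`, after translation, with `x` in a progression-free set `X`.
If a triple composed of coordinates of such elements lies in `Φⁿ`, then its hashes add up to `0`,
hence come from a single `x`, and freeness of collisions identifies the triple with each of these
elements. -/
theorem exists_matching_of_prime {p : ℕ} [Fact p.Prime] (u : ∀ i, κ i → ℤ)
    (hu : ∀ i, Function.Injective fun a => (u i a : ZMod p)) (Φ : Set (∀ i, κ i))
    (hΦ : ∀ α ∈ Φ, ∑ i, u i (α i) = 0) (Ψ : Finset (∀ i, Fin n → κ i)) (α : ∀ i, Fin n → κ i)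
    (hΨ : ∀ β, β ∈ Ψ ↔ β ∈ powSet Φ n ∧ ∀ i, β i ∈ typeClass (α i))
    (T : ℕ) (hT : ∀ i, T ≤ (typeClass (α i)).card) (hp : 6 * Ψ.card ≤ p * T) :
    ∃ S : Finset (∀ i, Fin n → κ i), (∀ β ∈ S, β ∈ powSet Φ n) ∧
      (∀ β : Fin 3 → ∀ i, Fin n → κ i, (∀ i, β i ∈ S) → (fun i => β i i) ∈ powSet Φ n →
        β 0 = β 1 ∧ β 1 = β 2) ∧
      Ψ.card * rothNumberNat (p / 2) ≤ 2 * p ^ 2 * S.card := by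
  classical
  have hperm : ∀ β ∈ Ψ, ∀ σ : Equiv.Perm (Fin n), (fun i => β i ∘ σ) ∈ Ψ := fun β hβ σ => by
    rw [hΨ] at hβ ⊢
    exact ⟨fun m => hβ.1 (σ m), fun i => comp_perm_mem_typeClass (hβ.2 i) σ⟩
  obtain ⟨w, Ψ', hsub, hw, hiso'⟩ := exists_weights u hu Ψ T (fun γ hγ i => by
    rw [← card_fiber_mul_card_typeClass Ψ α (fun β hβ => ((hΨ β).1 hβ).2) hperm γ hγ i]
    exact Nat.mul_le_mul_left _ (hT i)) hp
  obtain ⟨X, hXcard, hX⟩ := exists_progressionFree p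
  obtain ⟨ρ, σ, hρ⟩ := exists_shift Ψ' (fun β => wordHash (u 0) w (β 0))
    (fun β => wordHash (u 1) w (β 1)) X
  -- Tightness makes the third hash of an element of `Φⁿ` a function of the other two.
  have hzero : ∀ β ∈ powSet Φ n, wordHash (u 0) w (β 0) + wordHash (u 1) w (β 1) +
      wordHash (u 2) w (β 2) = 0 := fun β hβ => by
    simp only [wordHash, ← Finset.sum_add_distrib, ← mul_add]
    refine Finset.sum_eq_zero fun m _ => ?_
    have h1 := hΦ _ (hβ m)
    rw [Fin.sum_univ_three] at h1
    have h2 := congrArg (fun z : ℤ => (z : ZMod p)) h1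
    push_cast at h2
    rw [h2, mul_zero]
  refine ⟨Ψ'.filter fun β => wordHash (u 0) w (β 0) + ρ = wordHash (u 1) w (β 1) + σ ∧
    wordHash (u 0) w (β 0) + ρ ∈ X, fun β hβ => ?_, fun β hβ hmem => ?_, ?_⟩
  · exact ((hΨ β).1 (hsub (Finset.mem_filter.1 hβ).1)).1
  · have hΨm : ∀ i, β i ∈ Ψ := fun i =>
      hsub (Finset.mem_filter.1 (hβ i)).1
    have hiso := fun i => hiso' (β i) (Finset.mem_filter.1 (hβ i)).1
    have heq := fun i => (Finset.mem_filter.1 (hβ i)).2.1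
    have hXm := fun i => (Finset.mem_filter.1 (hβ i)).2.2
    have hpow := fun i => hzero (β i) ((hΨ _).1 (hΨm i)).1
    set γ : ∀ i, Fin n → κ i := fun i => β i i with hγ
    have hγΨ : γ ∈ Ψ := (hΨ _).2 ⟨hmem, fun i => ((hΨ _).1 (hΨm i)).2 i⟩
    have hz : wordHash (u 0) w (β 0 0) + wordHash (u 1) w (β 1 1) +
      wordHash (u 2) w (β 2 2) = 0 := hzero γ hmem
    obtain ⟨h02, h12⟩ := hX _ (hXm 0) _ (hXm 1) _ (hXm 2) (by
      linear_combination hz - hpow 2 + heq 1 - heq 2)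
    have e0 : ∀ i, wordHash (u 0) w (β i 0) = wordHash (u 0) w (β 0 0) := fun i => by
      fin_cases i
      · rfl
      · exact add_right_cancel (h12.trans h02.symm)
      · exact add_right_cancel h02.symm
    have e1 : ∀ i, wordHash (u 1) w (β i 1) = wordHash (u 1) w (β 1 1) := fun i => by
      linear_combination e0 i - e0 1 - heq i + heq 1
    have e2 : ∀ i, wordHash (u 2) w (β i 2) = wordHash (u 2) w (β 2 2) := fun i => by
      linear_combination hpow i - hpow 2 - e0 i + e0 2 - e1 i + e1 2
    have hall : ∀ i, γ = β i := fun i => hiso i γ hγΨ ⟨i, rfl⟩ fun j => by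
      fin_cases j
      · exact (e0 i).symm
      · exact (e1 i).symm
      · exact (e2 i).symm
    exact ⟨(hall 0).symm.trans (hall 1), (hall 1).symm.trans (hall 2)⟩
  · rw [← hXcard]
    calc Ψ.card * X.card ≤ 2 * Ψ'.card * X.card := Nat.mul_le_mul_right _ hw
      _ = 2 * (Ψ'.card * X.card) := by ring
      _ ≤ _ := by
        rw [mul_assoc 2]
        exact Nat.mul_le_mul_left _ hρ

end Matching

open Filter Topology

section MatchingSize

variable {κ : Fin 3 → Type*} [∀ i, Fintype (κ i)] [∀ i, DecidableEq (κ i)]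

theorem exists_forall_injective_cast {κ : Fin 3 → Type*} [∀ i, Fintype (κ i)]
    (u : ∀ i, κ i → ℤ) (hu : ∀ i, Function.Injective (u i)) :
    ∃ M : ℕ, 0 < M ∧ ∀ p, M < p → ∀ i, Function.Injective fun a => (u i a : ZMod p) := by
  let B : ℕ := ∑ i, ∑ a, (u i a).natAbs
  have hB : ∀ i a, (u i a).natAbs ≤ B := fun i a =>
    (Finset.single_le_sum (f := fun a => (u i a).natAbs) (fun _ _ => Nat.zero_le _)
      (Finset.mem_univ a)).trans
    (Finset.single_le_sum (f := fun i => ∑ a, (u i a).natAbs) (fun _ _ => Nat.zero_le _)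
      (Finset.mem_univ i))
  refine ⟨2 * B + 1, Nat.succ_pos _, fun p hp i a b h => hu i ?_⟩
  have h1 := (ZMod.intCast_eq_intCast_iff_dvd_sub _ _ _).1 h
  have h2 := hB i a
  have h3 := hB i b
  have := Int.eq_zero_of_abs_lt_dvd h1 (by rw [abs_lt]; omega)
  omega

/-- The growth estimate behind `exists_large_matching`, where Behrend's lower bound for the Roth
numbers enters. -/
theorem le_of_mul_rothNumberNat_le {D T p M s : ℕ} (hD : 0 < D) (hp2 : 2 ≤ p)
    (hpT : p * T ≤ 24 * M * D) (hT : 0 < T)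
    (h : D * rothNumberNat (p / 2) ≤ 2 * p ^ 2 * s) :
    (T : ℝ) ≤ s * (144 * M * Real.exp (4 * √(Real.log (24 * M * D : ℕ)))) := by
  have hR := Behrend.roth_lower_bound (N := p / 2)
  set e := Real.exp (4 * √(Real.log (24 * M * D : ℕ))) with he
  have he0 : 0 < e := Real.exp_pos _
  have hple : p / 2 ≤ 24 * M * D :=
    (Nat.div_le_self p 2).trans ((Nat.le_mul_of_pos_right p hT).trans hpT)
  have hE : e⁻¹ ≤ Real.exp (-4 * √(Real.log (p / 2 : ℕ))) := by
    rw [he, ← Real.exp_neg, Real.exp_le_exp, neg_mul, neg_le_neg_iff]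
    refine mul_le_mul_of_nonneg_left (Real.sqrt_le_sqrt (Real.log_le_log ?_ ?_)) (by norm_num)
    · exact_mod_cast (by omega : 0 < p / 2)
    · exact_mod_cast hple
  have hp3 : (p : ℝ) ≤ 3 * ((p / 2 : ℕ) : ℝ) := by exact_mod_cast (by omega : p ≤ 3 * (p / 2))
  have h1 : (p : ℝ) * e⁻¹ ≤ 3 * rothNumberNat (p / 2) :=
    calc (p : ℝ) * e⁻¹ ≤ 3 * ((p / 2 : ℕ) : ℝ) * e⁻¹ := by gcongr
      _ ≤ 3 * (((p / 2 : ℕ) : ℝ) * Real.exp (-4 * √(Real.log (p / 2 : ℕ)))) := by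
        rw [mul_assoc]; gcongr
      _ ≤ _ := by gcongr
  have h' : (D : ℝ) * rothNumberNat (p / 2) ≤ 2 * p ^ 2 * s := by exact_mod_cast h
  have hpT' : (p : ℝ) * T ≤ 24 * M * D := by exact_mod_cast hpT
  have hp0 : (0 : ℝ) < p := by exact_mod_cast (by omega : 0 < p)
  have hD0 : (0 : ℝ) < D := by exact_mod_cast hD
  have h2 : (D : ℝ) * e⁻¹ ≤ 6 * p * s := by
    have : p * (D * e⁻¹) ≤ p * (6 * p * s) := by
      calc p * (D * e⁻¹) = D * (p * e⁻¹) := by ring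
        _ ≤ D * (3 * rothNumberNat (p / 2)) := by gcongr
        _ = 3 * (D * rothNumberNat (p / 2)) := by ring
        _ ≤ 3 * (2 * p ^ 2 * s) := by gcongr
        _ = p * (6 * p * s) := by ring
    exact le_of_mul_le_mul_left this hp0
  have h3 : (T : ℝ) * e⁻¹ ≤ 144 * M * s := by
    have : D * (T * e⁻¹) ≤ D * (144 * M * s) := by
      calc D * (T * e⁻¹) = T * (D * e⁻¹) := by ring
        _ ≤ T * (6 * p * s) := by gcongr
        _ = 6 * s * (p * T) := by ring
        _ ≤ 6 * s * (24 * M * D) := by gcongr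
        _ = D * (144 * M * s) := by ring
    exact le_of_mul_le_mul_left this hD0
  calc (T : ℝ) = T * e⁻¹ * e := by field_simp
    _ ≤ 144 * M * s * e := by gcongr
    _ = _ := by ring

theorem tendsto_add_sqrt_div_atTop (a c : ℝ) :
    Tendsto (fun n : ℕ => (a + 4 * √(c * (n + 1))) / (n : ℝ)) atTop (𝓝 0) := by
  have h1 : Tendsto (fun n : ℕ => ((n : ℝ))⁻¹) atTop (𝓝 0) := tendsto_inv_atTop_nhds_zero_nat
  have h2 : Tendsto (fun n : ℕ => a * (n : ℝ)⁻¹ + 4 * √(c * ((n : ℝ)⁻¹ + (n : ℝ)⁻¹ ^ 2))) atTop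
      (𝓝 (a * 0 + 4 * √(c * (0 + 0 ^ 2)))) :=
    (h1.const_mul a).add (((h1.add (h1.pow 2)).const_mul c).sqrt.const_mul 4)
  simp only [mul_zero, add_zero, ne_eq, OfNat.ofNat_ne_zero, not_false_eq_true, zero_pow,
    Real.sqrt_zero] at h2
  refine h2.congr' ?_
  filter_upwards [eventually_gt_atTop 0] with n hn
  have hn' : (0 : ℝ) < n := by exact_mod_cast hn
  have h3 : c * ((n : ℝ)⁻¹ + (n : ℝ)⁻¹ ^ 2) = c * (n + 1) / (n : ℝ) ^ 2 := by
    field_simp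
  rw [h3, Real.sqrt_div' _ (by positivity), Real.sqrt_sq hn'.le]
  ring

/-- Let `α` be an element of the `n`-th power of a tight set. Then this power contains a matching
that is larger than the smallest of the type classes of the `αᵢ`, up to a subexponential factor. -/
theorem exists_large_matching (Φ : Set (∀ i, κ i)) (hΦ : IsTightSet Φ) :
    ∃ E : ℕ → ℝ, Tendsto (fun n : ℕ => E n / (n : ℝ)) atTop (𝓝 0) ∧
      ∀ (n : ℕ) (α : ∀ i, Fin n → κ i), α ∈ powSet Φ n →
      ∀ T : ℕ, 0 < T → (∀ i, T ≤ (typeClass (α i)).card) →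
      ∃ S : Finset (∀ i, Fin n → κ i), (∀ β ∈ S, β ∈ powSet Φ n) ∧
        (∀ β : Fin 3 → ∀ i, Fin n → κ i, (∀ i, β i ∈ S) → (fun i => β i i) ∈ powSet Φ n →
          β 0 = β 1 ∧ β 1 = β 2) ∧ (T : ℝ) ≤ S.card * Real.exp (E n) := by
  classical
  obtain ⟨u, hu, hsum⟩ := hΦ
  obtain ⟨M, hM, hinj⟩ := exists_forall_injective_cast u hu
  let K : ℕ := ∏ i, Fintype.card (κ i)
  let c : ℝ := Real.log (24 * M : ℕ) + Real.log K
  refine ⟨_, tendsto_add_sqrt_div_atTop (Real.log (144 * M : ℕ)) c,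
    fun n α hα T hT0 hT => ?_⟩
  let Ψ : Finset (∀ i, Fin n → κ i) :=
    Finset.univ.filter fun β => β ∈ powSet Φ n ∧ ∀ i, β i ∈ typeClass (α i)
  have hΨ : ∀ β, β ∈ Ψ ↔ β ∈ powSet Φ n ∧ ∀ i, β i ∈ typeClass (α i) := fun β => by simp [Ψ]
  have hαΨ : α ∈ Ψ := (hΨ α).2 ⟨hα, fun i => self_mem_typeClass _⟩
  have hD0 : 0 < Ψ.card := Finset.card_pos.2 ⟨α, hαΨ⟩
  have hTD : T ≤ Ψ.card := by
    have h1 := card_fiber_mul_card_typeClass Ψ α (fun β hβ => ((hΨ β).1 hβ).2)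
      (fun β hβ σ => (hΨ _).2 ⟨fun m => ((hΨ β).1 hβ).1 (σ m),
        fun i => comp_perm_mem_typeClass (((hΨ β).1 hβ).2 i) σ⟩) α hαΨ 0
    have h2 : 0 < (Ψ.filter fun β => β 0 = α 0).card :=
      Finset.card_pos.2 ⟨α, Finset.mem_filter.2 ⟨hαΨ, rfl⟩⟩
    rw [← h1]
    exact (hT 0).trans (Nat.le_mul_of_pos_left _ h2)
  have hDK : Ψ.card ≤ K ^ n := by
    refine (Finset.card_le_univ _).trans ?_
    simp [K, Finset.prod_pow]
  -- Up to a constant, the modulus is `|Ψ| / T`, which bounds the number of elements of `Ψ` with a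
  -- given coordinate; the factor `M` keeps the labels distinct modulo `p`.
  obtain ⟨p, hp, hlt, hle⟩ := Nat.exists_prime_lt_and_le_two_mul (6 * (Ψ.card / T + 1) * M)
    (by positivity)
  have : Fact p.Prime := ⟨hp⟩
  have h1 : Ψ.card < (Ψ.card / T + 1) * T := by
    have := Nat.lt_div_mul_add hT0 (a := Ψ.card)
    linarith
  have h2 : (Ψ.card / T + 1) * T ≤ 2 * Ψ.card := by
    have := Nat.div_mul_le_self Ψ.card T
    linarith
  have hpT : p * T ≤ 24 * M * Ψ.card :=
    calc p * T ≤ 2 * (6 * (Ψ.card / T + 1) * M) * T := Nat.mul_le_mul_right _ hle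
      _ = 12 * M * ((Ψ.card / T + 1) * T) := by ring
      _ ≤ 12 * M * (2 * Ψ.card) := Nat.mul_le_mul_left _ h2
      _ = _ := by ring
  have h6 : 6 * Ψ.card ≤ p * T :=
    calc 6 * Ψ.card ≤ 6 * ((Ψ.card / T + 1) * T) * M :=
          (Nat.mul_le_mul_left _ h1.le).trans (Nat.le_mul_of_pos_right _ hM)
      _ = 6 * (Ψ.card / T + 1) * M * T := by ring
      _ ≤ p * T := Nat.mul_le_mul_right _ hlt.le
  have hMp : M < p := (Nat.le_mul_of_pos_left M (by positivity)).trans_lt hlt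
  obtain ⟨S, hS, hmatch, hcard⟩ :=
    exists_matching_of_prime u (hinj p hMp) Φ hsum Ψ α hΨ T hT h6
  refine ⟨S, hS, hmatch, (le_of_mul_rothNumberNat_le hD0 hp.two_le hpT hT0 hcard).trans ?_⟩
  have hM' : (0 : ℝ) < (144 * M : ℕ) := by exact_mod_cast (by omega : 0 < 144 * M)
  rw [Real.exp_add, Real.exp_log hM']
  push_cast
  have hlog : Real.log (24 * M * Ψ.card : ℕ) ≤ c * (n + 1) := by
    have h24 : 0 < 24 * M := by omega
    have e1 : Real.log (24 * M * Ψ.card : ℕ) =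
        Real.log (24 * M : ℕ) + Real.log Ψ.card := by
      rw [Nat.cast_mul, Real.log_mul (by exact_mod_cast h24.ne') (by exact_mod_cast hD0.ne')]
    have e2 : Real.log Ψ.card ≤ n * Real.log K := by
      rw [← Real.log_pow]
      exact Real.log_le_log (by exact_mod_cast hD0) (by exact_mod_cast hDK)
    have e3 : 0 ≤ Real.log (24 * M : ℕ) := Real.log_natCast_nonneg _
    have e4 : 0 ≤ Real.log K := Real.log_natCast_nonneg _
    have e5 : (0 : ℝ) ≤ n := Nat.cast_nonneg n
    rw [e1]
    simp only [c]
    nlinarith [mul_nonneg e3 e5]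
  push_cast at hlog
  gcongr

end MatchingSize

/-! ### The growth rate -/

section Growth

variable {κ : Fin 3 → Type*} [∀ i, Fintype (κ i)] [∀ i, DecidableEq (κ i)]

open Classical in
/-- The maximum over all `α ∈ Φⁿ` of the size of the smallest of the type classes of the `αᵢ`. -/
noncomputable def maxMinTypeClass (Φ : Set (∀ i, κ i)) (n : ℕ) : ℕ :=
  (Finset.univ.filter (· ∈ powSet Φ n)).sup fun α =>
    Finset.univ.inf' Finset.univ_nonempty fun i => (typeClass (α i)).card

theorem exists_card_typeClass_le {Φ : Set (∀ i, κ i)} {n : ℕ} {α : ∀ i, Fin n → κ i}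
    (hα : α ∈ powSet Φ n) : ∃ i, (typeClass (α i)).card ≤ maxMinTypeClass Φ n := by
  classical
  obtain ⟨i, -, hi⟩ := Finset.exists_mem_eq_inf' (Finset.univ_nonempty (α := Fin 3))
    fun i => (typeClass (α i)).card
  refine ⟨i, hi ▸ ?_⟩
  exact Finset.le_sup (f := fun α : ∀ i, Fin n → κ i =>
    Finset.univ.inf' Finset.univ_nonempty fun i => (typeClass (α i)).card)
    (Finset.mem_filter.2 ⟨Finset.mem_univ α, hα⟩)

theorem le_maxMinTypeClass {Φ : Set (∀ i, κ i)} {n T : ℕ} {α : ∀ i, Fin n → κ i}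
    (hα : α ∈ powSet Φ n) (h : ∀ i, T ≤ (typeClass (α i)).card) : T ≤ maxMinTypeClass Φ n := by
  obtain ⟨i, hi⟩ := exists_card_typeClass_le hα
  exact (h i).trans hi

theorem exists_maxMinTypeClass_le {Φ : Set (∀ i, κ i)} (hΦ : Φ.Nonempty) (n : ℕ) :
    ∃ α ∈ powSet Φ n, ∀ i, maxMinTypeClass Φ n ≤ (typeClass (α i)).card := by
  classical
  obtain ⟨φ, hφ⟩ := hΦ
  obtain ⟨α, hα, h⟩ := Finset.exists_mem_eq_sup
    (Finset.univ.filter fun α : ∀ i, Fin n → κ i => α ∈ powSet Φ n)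
    ⟨fun i _ => φ i, Finset.mem_filter.2 ⟨Finset.mem_univ _, fun _ => hφ⟩⟩
    fun α => Finset.univ.inf' Finset.univ_nonempty fun i => (typeClass (α i)).card
  refine ⟨α, (Finset.mem_filter.1 hα).2, fun i => ?_⟩
  have h' : maxMinTypeClass Φ n = _ := h
  rw [h']
  exact Finset.inf'_le _ (Finset.mem_univ i)

theorem maxMinTypeClass_pos {Φ : Set (∀ i, κ i)} (hΦ : Φ.Nonempty) (n : ℕ) :
    0 < maxMinTypeClass Φ n := by
  obtain ⟨φ, hφ⟩ := hΦ
  exact le_maxMinTypeClass (α := fun i _ => φ i) (fun _ => hφ) fun i => card_typeClass_pos _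

theorem maxMinTypeClass_mul_le {Φ : Set (∀ i, κ i)} (hΦ : Φ.Nonempty) (m n : ℕ) :
    maxMinTypeClass Φ m * maxMinTypeClass Φ n ≤ maxMinTypeClass Φ (m + n) := by
  obtain ⟨α, hα, ha⟩ := exists_maxMinTypeClass_le hΦ m
  obtain ⟨β, hβ, hb⟩ := exists_maxMinTypeClass_le hΦ n
  refine le_maxMinTypeClass (α := fun i => Fin.append (α i) (β i)) (fun l => ?_) fun i =>
    (Nat.mul_le_mul (ha i) (hb i)).trans (card_typeClass_mul_le _ _)
  refine Fin.addCases (fun l => ?_) (fun l => ?_) l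
  · simpa using hα l
  · simpa using hβ l

theorem exists_tendsto_log_maxMinTypeClass {Φ : Set (∀ i, κ i)} (hΦ : Φ.Nonempty) :
    ∃ l : ℝ, Tendsto (fun n : ℕ => Real.log (maxMinTypeClass Φ n) / n) atTop (𝓝 l) := by
  have hpos : ∀ n, (0 : ℝ) < maxMinTypeClass Φ n := fun n => by
    exact_mod_cast maxMinTypeClass_pos hΦ n
  have hsub : Subadditive fun n : ℕ => -Real.log (maxMinTypeClass Φ n) := fun m n => by
    have h := Real.log_le_log (mul_pos (hpos m) (hpos n))
      (show _ ≤ (maxMinTypeClass Φ (m + n) : ℝ) by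
        exact_mod_cast maxMinTypeClass_mul_le hΦ m n)
    rw [Real.log_mul (hpos m).ne' (hpos n).ne'] at h
    simp only
    linarith
  have hbdd : BddBelow (Set.range fun n : ℕ => -Real.log (maxMinTypeClass Φ n) / n) := by
    refine ⟨-Real.log (Fintype.card (κ 0)), ?_⟩
    rintro _ ⟨n, rfl⟩
    simp only
    obtain ⟨α, -, ha⟩ := exists_maxMinTypeClass_le hΦ n
    have h1 : maxMinTypeClass Φ n ≤ Fintype.card (κ 0) ^ n :=
      (ha 0).trans ((Finset.card_le_univ _).trans (by simp))
    have h2 : Real.log (maxMinTypeClass Φ n) ≤ n * Real.log (Fintype.card (κ 0)) := by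
      rw [← Real.log_pow]
      exact Real.log_le_log (hpos n) (by exact_mod_cast h1)
    rw [neg_div, neg_le_neg_iff]
    exact div_le_of_le_mul₀ (Nat.cast_nonneg n) (Real.log_natCast_nonneg _) (by linarith)
  refine ⟨-hsub.lim, (hsub.tendsto_lim hbdd).neg.congr fun n => ?_⟩
  rw [neg_div, neg_neg]

end Growth

/-! ### Ranks of powers of tight tensors -/

section Powers

variable {F : Type*} [Field F] {V : Fin 3 → Type*} [∀ i, AddCommGroup (V i)] [∀ i, Module F (V i)]
  {κ : Fin 3 → Type*}

theorem tensorSupport_tensorPow (b : ∀ i, Basis (κ i) F (V i)) (t : ⨂[F] i, V i) (n : ℕ) :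
    tensorSupport (fun i => Basis.piTensorProduct fun _ : Fin n => b i) (tensorPow t n) =
      powSet (tensorSupport b t) n := by
  ext α
  simp only [tensorSupport, powSet, Set.mem_ofPred_eq, tensorPow_repr, Finset.prod_ne_zero_iff,
    Finset.mem_univ, true_imp_iff]

variable [∀ i, Fintype (κ i)] [∀ i, DecidableEq (κ i)]

/-- Every support position of `t^{⊗n}` has a coordinate in a type class of size at most
`maxMinTypeClass`, and the words in such type classes are few. -/
theorem sliceRank_tensorPow_le (b : ∀ i, Basis (κ i) F (V i)) (t : ⨂[F] i, V i) (n : ℕ) :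
    sliceRank (tensorPow t n) ≤ 3 * (n + 1) ^ (∑ i, Fintype.card (κ i)) *
      maxMinTypeClass (tensorSupport b t) n := by
  have h := sliceRank_le_of_support_covered
    (fun i => Basis.piTensorProduct fun _ : Fin n => b i) (tensorPow t n)
    (fun i => Finset.univ.filter fun a : Fin n → κ i =>
      (typeClass a).card ≤ maxMinTypeClass (tensorSupport b t) n) (fun α hα => by
      rw [tensorSupport_tensorPow] at hα
      obtain ⟨i, hi⟩ := exists_card_typeClass_le hα
      exact ⟨i, Finset.mem_filter.2 ⟨Finset.mem_univ _, hi⟩⟩)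
  refine h.trans ((Finset.sum_le_sum fun i _ => (card_filter_typeClass_le n _).trans
    (Nat.mul_le_mul_right _ (Nat.pow_le_pow_right (Nat.succ_pos n)
      (Finset.single_le_sum (f := fun i => Fintype.card (κ i)) (fun _ _ => Nat.zero_le _)
        (Finset.mem_univ i))))).trans ?_)
  simp [mul_assoc]

theorem maxMinTypeClass_le_subrank_tensorPow [∀ i, FiniteDimensional F (V i)]
    (b : ∀ i, Basis (κ i) F (V i)) (t : ⨂[F] i, V i) (hne : (tensorSupport b t).Nonempty)
    (ht : IsTightSet (tensorSupport b t)) :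
    ∃ E : ℕ → ℝ, Tendsto (fun n : ℕ => E n / (n : ℝ)) atTop (𝓝 0) ∧
      ∀ n : ℕ, (maxMinTypeClass (tensorSupport b t) n : ℝ) ≤
        subrank (tensorPow t n) * Real.exp (E n) := by
  obtain ⟨E, hE, h⟩ := exists_large_matching _ ht
  refine ⟨E, hE, fun n => ?_⟩
  obtain ⟨α, hα, ha⟩ := exists_maxMinTypeClass_le hne n
  obtain ⟨S, hS, hmatch, hcard⟩ := h n α hα _ (maxMinTypeClass_pos hne n) ha
  refine hcard.trans (mul_le_mul_of_nonneg_right ?_ (Real.exp_pos _).le)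
  let bn := fun i => Basis.piTensorProduct fun _ : Fin n => b i
  have : ∀ i, FiniteDimensional F (⨂[F]^n (V i)) := fun i => (bn i).finiteDimensional_of_finite
  have := le_subrank_of_matching bn (tensorPow t n) (fun l => (S.equivFin.symm l).1)
    (fun l => by
      rw [tensorSupport_tensorPow]
      exact hS _ (S.equivFin.symm l).2)
    (fun l hl => by
      rw [tensorSupport_tensorPow] at hl
      have := hmatch (fun i => (S.equivFin.symm (l i)).1) (fun i => (S.equivFin.symm (l i)).2) hl
      exact ⟨S.equivFin.symm.injective (Subtype.ext this.1),
        S.equivFin.symm.injective (Subtype.ext this.2)⟩)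
  exact_mod_cast this

theorem tensorPow_zero_left {n : ℕ} (hn : 0 < n) : tensorPow (0 : ⨂[F] i, V i) n = 0 := by
  obtain ⟨m, rfl⟩ := Nat.exists_eq_succ_of_ne_zero hn.ne'
  simp [tensorPow]

theorem sliceRank_zero : sliceRank (0 : ⨂[F] i, V i) = 0 :=
  Nat.le_zero.1 (Nat.sInf_le ⟨fun _ => 0, fun l => l.elim0, by simp⟩)

end Powers

theorem tendsto_rpow_one_div_of_log {f : ℕ → ℕ} {l : ℝ} (hf : ∀ n, 0 < f n)
    (h : Tendsto (fun n : ℕ => Real.log (f n) / n) atTop (𝓝 l)) :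
    Tendsto (fun n : ℕ => (f n : ℝ) ^ (1 / (n : ℝ))) atTop (𝓝 (Real.exp l)) :=
  ((Real.continuous_exp.tendsto l).comp h).congr fun n => by
    rw [Real.rpow_def_of_pos (by exact_mod_cast hf n), Function.comp_apply, mul_one_div]

theorem tendsto_log_polynomial_div_atTop (k : ℕ) :
    Tendsto (fun n : ℕ => Real.log (3 * ((n : ℝ) + 1) ^ k) / n) atTop (𝓝 0) := by
  have h0 : Tendsto (fun n : ℕ => (n : ℝ) + 1) atTop atTop :=
    tendsto_atTop_add_const_right _ _ tendsto_natCast_atTop_atTop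
  have h1 : Tendsto (fun n : ℕ => Real.log ((n : ℝ) + 1) / ((n : ℝ) + 1)) atTop (𝓝 0) :=
    (Real.isLittleO_log_id_atTop.tendsto_div_nhds_zero).comp h0
  have h2 : Tendsto (fun n : ℕ => ((n : ℝ))⁻¹) atTop (𝓝 0) := tendsto_inv_atTop_nhds_zero_nat
  have h3 := (h2.const_mul (Real.log 3)).add ((h1.mul (h2.const_add 1)).const_mul (k : ℝ))
  simp only [mul_zero, add_zero, zero_mul] at h3
  refine h3.congr' ?_
  filter_upwards [eventually_gt_atTop 0] with n hn
  have hn' : (0 : ℝ) < n := by exact_mod_cast hn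
  rw [Real.log_mul (by norm_num) (by positivity), Real.log_pow]
  field_simp

end TensorRanks

theorem mainTheorem10 {F : Type*} [Field F] {V : Fin 3 → Type*}
    [∀ i, AddCommGroup (V i)] [∀ i, Module F (V i)] [∀ i, FiniteDimensional F (V i)]
    (t : ⨂[F] i, V i) (ht : TensorRanks.IsTight t) :
    ∃ L : ℝ,
      Filter.Tendsto
        (fun n : ℕ => (TensorRanks.sliceRank (TensorRanks.tensorPow t n) : ℝ) ^ (1 / (n : ℝ)))
        Filter.atTop (nhds L) ∧
      Filter.Tendsto
        (fun n : ℕ => (TensorRanks.subrank (TensorRanks.tensorPow t n) : ℝ) ^ (1 / (n : ℝ)))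
        Filter.atTop (nhds L) := by
  open TensorRanks Filter in
  obtain ⟨b, hb⟩ := ht
  have hfin : ∀ n i, FiniteDimensional F (⨂[F]^n (V i)) := fun n i =>
    (Basis.piTensorProduct fun _ : Fin n => b i).finiteDimensional_of_finite
  have hQS : ∀ n, subrank (tensorPow t n) ≤ sliceRank (tensorPow t n) := fun n =>
    subrank_le_sliceRank _
  rcases Set.eq_empty_or_nonempty (tensorSupport b t) with h0 | hne
  · have ht0 : t = 0 := by
      refine (Basis.piTensorProduct b).repr.injective (Finsupp.ext fun α => ?_)
      by_contra h
      have : α ∈ tensorSupport b t := by simpa [tensorSupport] using h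
      simp [h0] at this
    have hS : ∀ n, 0 < n → sliceRank (tensorPow t n) = 0 := fun n hn => by
      rw [ht0, tensorPow_zero_left hn, sliceRank_zero]
    have hQ : ∀ n, 0 < n → subrank (tensorPow t n) = 0 := fun n hn =>
      Nat.le_zero.1 ((hQS n).trans (hS n hn).le)
    refine ⟨0, tendsto_const_nhds.congr' ?_, tendsto_const_nhds.congr' ?_⟩ <;>
      filter_upwards [eventually_gt_atTop 0] with n hn
    · rw [hS n hn, Nat.cast_zero, Real.zero_rpow (by positivity)]
    · rw [hQ n hn, Nat.cast_zero, Real.zero_rpow (by positivity)]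
  · obtain ⟨E, hE, hlow⟩ := maxMinTypeClass_le_subrank_tensorPow b t hne hb
    obtain ⟨l, hl⟩ := exists_tendsto_log_maxMinTypeClass hne
    set N := maxMinTypeClass (tensorSupport b t)
    have hN : ∀ n, (0 : ℝ) < N n := fun n => by exact_mod_cast maxMinTypeClass_pos hne n
    have hQ0 : ∀ n, 0 < subrank (tensorPow t n) := fun n => by
      rcases Nat.eq_zero_or_pos (subrank (tensorPow t n)) with h | h
      · have := (hN n).trans_le (hlow n)
        simp [h] at this
      · exact h
    have hS0 : ∀ n, 0 < sliceRank (tensorPow t n) := fun n => (hQ0 n).trans_le (hQS n)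
    set k := ∑ i, Fintype.card (Fin (Module.finrank F (V i)))
    have hlo : Tendsto (fun n : ℕ => Real.log (N n) / n - E n / n) atTop (nhds l) := by
      simpa using hl.sub hE
    have hhi : Tendsto (fun n : ℕ => Real.log (3 * ((n : ℝ) + 1) ^ k) / n + Real.log (N n) / n)
        atTop (nhds l) := by
      simpa using (tendsto_log_polynomial_div_atTop k).add hl
    have hQlow : ∀ n : ℕ, Real.log (N n) / n - E n / n ≤
        Real.log (subrank (tensorPow t n)) / n := fun n => by
      have h1 := Real.log_le_log (hN n) (hlow n)
      rw [Real.log_mul (by exact_mod_cast (hQ0 n).ne') (Real.exp_pos _).ne', Real.log_exp] at h1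
      rw [← sub_div]
      exact div_le_div_of_nonneg_right (by linarith) (Nat.cast_nonneg n)
    have hmid : ∀ n : ℕ, Real.log (subrank (tensorPow t n)) / n ≤
        Real.log (sliceRank (tensorPow t n)) / n := fun n =>
      div_le_div_of_nonneg_right (Real.log_le_log (by exact_mod_cast hQ0 n)
        (by exact_mod_cast hQS n)) (Nat.cast_nonneg n)
    have hShi : ∀ n : ℕ, Real.log (sliceRank (tensorPow t n)) / n ≤
        Real.log (3 * ((n : ℝ) + 1) ^ k) / n + Real.log (N n) / n := fun n => by
      rw [← add_div, ← Real.log_mul (by positivity) (hN n).ne']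
      refine div_le_div_of_nonneg_right (Real.log_le_log (by exact_mod_cast hS0 n) ?_)
        (Nat.cast_nonneg n)
      exact_mod_cast sliceRank_tensorPow_le b t n
    exact ⟨Real.exp l,
      tendsto_rpow_one_div_of_log hS0 (tendsto_of_tendsto_of_tendsto_of_le_of_le hlo hhi
        (fun n => (hQlow n).trans (hmid n)) hShi),
      tendsto_rpow_one_div_of_log hQ0 (tendsto_of_tendsto_of_tendsto_of_le_of_le hlo hhi
        hQlow fun n => (hmid n).trans (hShi n))⟩
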